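/- A skew (left) brace is a set $B$ with two (not necessarily abelian) group structures $(B,+)$ and $(B,\circ)$ such that $a\circ(b+c)=a\circ b-a+a\circ c$ for all $a,b,c\in B$. Write $\lambda_a(b)=-a+a\circ b$ and $a\ast b=-a+a\circ b-b$. For $x\in B$ let $\operatorname{Fix}^r(x)=\{b\in B: x\ast b=0\}$ (a subgroup of $(B,+)$) and $\operatorname{Fix}^l(x)=\{b\in B: b\ast x=0\}$ (a subgroup of $(B,\circ)$), and let $C_x^+$ and $C_x^\circ$ be the centralisers of $x$ in $(B,+)$ and in $(B,\circ)$. The skew brace $B$ has property (S) if, for every $x\in B$, the indices $|(B,+):\operatorname{Fix}^r(x)\cap C_x^+|$ and $|(B,\circ):\operatorname{Fix}^l(x)\cap C_x^\circ|$ are finite. An ideal of $B$ is a subgroup $I$ of $(B,+)$ that is normal in both $(B,+)$ and $(B,\circ)$ and satisfies $\lambda_a(I)\subseteq I$ for all $a\in B$; then $B/I$ is a skew brace with the induced operations. Let $T_+(B)$ and $T_\circ(B)$ be the sets of elements of finite order of $(B,+)$ and of $(B,\circ)$, respectively. Call $B$ finitely generated if there is a finite subset $E\subseteq B$ such that the smallest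 sub-skew brace (subset that is a subgroup of both $(B,+)$ and $(B,\circ)$) of $B$ containing $E$ is $B$ itself. **Theorem.** Let $B$ be a skew brace with property (S). Then: (1) $T_+(B)=T_\circ(B)$. (2) $T_+(B)$ is an ideal of $B$. (3) $T_+\big(B/T_+(B)\big)=\{0\}$. (4) If $B$ is finitely generated, then $T_+(B)$ is finite. -/

import Mathlib

/-- A skew (left) brace: a set with two group structures, `(B, +)` (not necessarily abelian) and
`(B, ∘)`, where `∘` is written `*`, such that `a ∘ (b + c) = a ∘ b - a + a ∘ c`. -/
class SkewBrace (B : Type*) extends AddGroup B, Group B where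
  skew_distrib : ∀ a b c : B, a * (b + c) = a * b - a + a * c

namespace SkewBrace

section Basic

variable {B : Type*} [SkewBrace B]

/-- The map `λ_a(b) = -a + a ∘ b`. -/
def lam (a b : B) : B := -a + a * b

/-- The third operation `a ∗ b = λ_a(b) - b = -a + a ∘ b - b`. -/
def astOp (a b : B) : B := -a + a * b - b

theorem astOp_eq_zero_iff (a b : B) : astOp a b = 0 ↔ lam a b = b := by
  simp only [astOp, lam, sub_eq_zero]

theorem mul_eq_add_lam (a b : B) : a * b = a + lam a b := by
  simp only [lam, add_neg_cancel_left]

theorem lam_add (a b c : B) : lam a (b + c) = lam a b + lam a c := by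
  simp only [lam, skew_distrib, sub_eq_add_neg, add_assoc]

theorem lam_zero (a : B) : lam a 0 = 0 := by
  have h := lam_add a 0 0
  rw [add_zero] at h
  exact left_eq_add.mp h

theorem lam_neg (a b : B) : lam a (-b) = -lam a b := by
  refine eq_neg_of_add_eq_zero_left ?_
  rw [← lam_add, neg_add_cancel, lam_zero]

theorem mul_zero_eq (a : B) : a * 0 = a := by
  rw [mul_eq_add_lam, lam_zero, add_zero]

theorem one_eq_zero : (1 : B) = 0 := by
  have h := mul_zero_eq (1 : B)
  rw [one_mul] at h
  exact h.symm

theorem lam_mul (a b c : B) : lam (a * b) c = lam a (lam b c) := by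
  have h : a * (b * c) = a + (lam a b + lam a (lam b c)) := by
    rw [mul_eq_add_lam b c, mul_eq_add_lam a, lam_add]
  rw [lam, mul_assoc, h, mul_eq_add_lam a b, ← add_assoc a, neg_add_cancel_left]

theorem lam_one (b : B) : lam 1 b = b := by
  rw [lam, one_mul, one_eq_zero, neg_zero, zero_add]

theorem lam_inv_lam (a b : B) : lam a⁻¹ (lam a b) = b := by
  rw [← lam_mul, inv_mul_cancel, lam_one]

theorem lam_inv_self (a : B) : lam a⁻¹ a = -a⁻¹ := by
  rw [lam, inv_mul_cancel, one_eq_zero, add_zero]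

/-- `Fix^r(x) = {b : x ∗ b = 0}`, a subgroup of `(B, +)`. -/
def fixR (x : B) : AddSubgroup B where
  carrier := {b | astOp x b = 0}
  zero_mem' := by
    simp only [Set.mem_ofPred_eq, astOp_eq_zero_iff, lam_zero]
  add_mem' := by
    intro a b ha hb
    simp only [Set.mem_ofPred_eq, astOp_eq_zero_iff] at ha hb ⊢
    rw [lam_add, ha, hb]
  neg_mem' := by
    intro a ha
    simp only [Set.mem_ofPred_eq, astOp_eq_zero_iff] at ha ⊢
    rw [lam_neg, ha]

/-- `Fix^l(x) = {b : b ∗ x = 0}`, a subgroup of `(B, ∘)`. -/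
def fixL (x : B) : Subgroup B where
  carrier := {b | astOp b x = 0}
  one_mem' := by
    simp only [Set.mem_ofPred_eq, astOp_eq_zero_iff, lam_one]
  mul_mem' := by
    intro a b ha hb
    simp only [Set.mem_ofPred_eq, astOp_eq_zero_iff] at ha hb ⊢
    rw [lam_mul, hb, ha]
  inv_mem' := by
    intro a ha
    simp only [Set.mem_ofPred_eq, astOp_eq_zero_iff] at ha ⊢
    have h := lam_inv_lam a x
    rwa [ha] at h

/-- `x` has property (s): `|(B,+) : Fix^r(x) ∩ C_x^+|` and `|(B,∘) : Fix^l(x) ∩ C_x^∘|` are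
finite. -/
def HasPropertySmallS (x : B) : Prop :=
  (fixR x ⊓ AddSubgroup.centralizer {x}).FiniteIndex ∧
    (fixL x ⊓ Subgroup.centralizer {x}).FiniteIndex

end Basic

/-- A skew brace has property (S) if all of its elements have property (s). -/
def HasPropertyS (B : Type*) [SkewBrace B] : Prop :=
  ∀ x : B, HasPropertySmallS x

/-- `T_+(B)`: the set of periodic elements of the additive group `(B, +)`. -/
def addTorsionSet (B : Type*) [SkewBrace B] : Set B :=
  {a | IsOfFinAddOrder a}

/-- `T_∘(B)`: the set of periodic elements of the multiplicative group `(B, ∘)`. -/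
def mulTorsionSet (B : Type*) [SkewBrace B] : Set B :=
  {a | IsOfFinOrder a}

/-- A sub-skew brace: a subset that is a subgroup of both `(B, +)` and `(B, ∘)`. -/
structure SubSkewBrace (B : Type*) [SkewBrace B] extends AddSubgroup B, Subgroup B

/-- `B` is finitely generated: for some finite `E`, the only sub-skew brace of `B` containing `E`
is `B` itself. -/
def IsFinitelyGenerated (B : Type*) [SkewBrace B] : Prop :=
  ∃ E : Finset B, ∀ S : SubSkewBrace B, (E : Set B) ⊆ S.carrier → S.carrier = Set.univ

/-- An ideal: a subgroup of `(B, +)` that is `λ`-invariant, normal in `(B, +)` and normal in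
`(B, ∘)`. (That it is a subgroup of `(B, ∘)` is automatic, see `BraceIdeal.toSubgroup`.) -/
structure BraceIdeal (B : Type*) [SkewBrace B] extends AddSubgroup B where
  lam_mem : ∀ a x : B, x ∈ carrier → lam a x ∈ carrier
  add_conj_mem : ∀ a x : B, x ∈ carrier → a + x - a ∈ carrier
  mul_conj_mem : ∀ a x : B, x ∈ carrier → a * x * a⁻¹ ∈ carrier

namespace BraceIdeal

variable {B : Type*} [SkewBrace B] (I : BraceIdeal B)

/-- An ideal as a subgroup of `(B, ∘)`. -/
def toSubgroup : Subgroup B where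
  carrier := I.carrier
  one_mem' := by
    rw [one_eq_zero]
    exact I.zero_mem'
  mul_mem' := by
    intro a b ha hb
    rw [mul_eq_add_lam]
    exact I.add_mem' ha (I.lam_mem a b hb)
  inv_mem' := by
    intro a ha
    have h := I.neg_mem' (I.lam_mem a⁻¹ a ha)
    rwa [lam_inv_self, neg_neg] at h

theorem normal_toAddSubgroup : I.toAddSubgroup.Normal :=
  ⟨fun x hx a => by
    rw [← sub_eq_add_neg]
    exact I.add_conj_mem a x hx⟩

theorem normal_toSubgroup : I.toSubgroup.Normal :=
  ⟨fun x hx a => I.mul_conj_mem a x hx⟩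

/-- The additive and the multiplicative cosets of an ideal coincide: `a + I = a ∘ I`. -/
theorem neg_add_mem_iff (x y : B) : -x + y ∈ I.toAddSubgroup ↔ x⁻¹ * y ∈ I.toSubgroup := by
  have h : -x + y = lam x (x⁻¹ * y) := by
    rw [lam, mul_inv_cancel_left]
  rw [h]
  constructor
  · intro hm
    have h2 := I.lam_mem x⁻¹ _ hm
    rwa [lam_inv_lam] at h2
  · intro hm
    exact I.lam_mem x _ hm

/-- The quotient `B / I`: the set of (additive, equivalently multiplicative) cosets of `I`. -/
def Quotient : Type _ := B ⧸ I.toAddSubgroup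

/-- The projection `B → B / I`. -/
def proj (x : B) : I.Quotient := QuotientAddGroup.mk x

theorem proj_surjective : Function.Surjective I.proj := QuotientAddGroup.mk_surjective

theorem proj_eq_iff_add (x y : B) : I.proj x = I.proj y ↔ -x + y ∈ I.toAddSubgroup :=
  QuotientAddGroup.eq

theorem proj_eq_iff_mul (x y : B) :
    I.proj x = I.proj y ↔ (x : B ⧸ I.toSubgroup) = (y : B ⧸ I.toSubgroup) := by
  rw [proj_eq_iff_add, neg_add_mem_iff, QuotientGroup.eq]

instance : AddGroup I.Quotient :=
  letI := I.normal_toAddSubgroup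
  inferInstanceAs (AddGroup (B ⧸ I.toAddSubgroup))

theorem proj_add (x y : B) : I.proj (x + y) = I.proj x + I.proj y := rfl

theorem proj_neg (x : B) : I.proj (-x) = -I.proj x := rfl

instance : Mul I.Quotient where
  mul p q := _root_.Quotient.liftOn₂ p q (fun x y => I.proj (x * y)) (by
    intro a b c d hac hbd
    have h1 := (I.proj_eq_iff_mul a c).mp (_root_.Quotient.sound hac)
    have h2 := (I.proj_eq_iff_mul b d).mp (_root_.Quotient.sound hbd)
    have := I.normal_toSubgroup
    rw [proj_eq_iff_mul, QuotientGroup.mk_mul, QuotientGroup.mk_mul, h1, h2])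

instance : One I.Quotient := ⟨I.proj 1⟩

instance : Inv I.Quotient where
  inv p := _root_.Quotient.liftOn p (fun x => I.proj x⁻¹) (by
    intro a c hac
    have h1 := (I.proj_eq_iff_mul a c).mp (_root_.Quotient.sound hac)
    have := I.normal_toSubgroup
    rw [proj_eq_iff_mul, QuotientGroup.mk_inv, QuotientGroup.mk_inv, h1])

theorem proj_mul (x y : B) : I.proj (x * y) = I.proj x * I.proj y := rfl

theorem proj_inv (x : B) : I.proj x⁻¹ = (I.proj x)⁻¹ := rfl

theorem proj_one : I.proj 1 = 1 := rfl

instance : Group I.Quotient :=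
  Group.ofLeftAxioms
    (by
      intro a b c
      obtain ⟨a, rfl⟩ := I.proj_surjective a
      obtain ⟨b, rfl⟩ := I.proj_surjective b
      obtain ⟨c, rfl⟩ := I.proj_surjective c
      simp only [← proj_mul, mul_assoc])
    (by
      intro a
      obtain ⟨a, rfl⟩ := I.proj_surjective a
      rw [← proj_one, ← proj_mul, one_mul])
    (by
      intro a
      obtain ⟨a, rfl⟩ := I.proj_surjective a
      rw [← proj_inv, ← proj_mul, inv_mul_cancel, proj_one])

/-- The quotient skew brace `B / I`, with both operations induced from `B`. -/
instance : SkewBrace I.Quotient where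
  skew_distrib a b c := by
    obtain ⟨a, rfl⟩ := I.proj_surjective a
    obtain ⟨b, rfl⟩ := I.proj_surjective b
    obtain ⟨c, rfl⟩ := I.proj_surjective c
    rw [sub_eq_add_neg, ← proj_add, ← proj_mul, ← proj_mul, ← proj_mul, ← proj_neg, ← proj_add, ← proj_add,
      skew_distrib, sub_eq_add_neg]

end BraceIdeal

end SkewBrace

/-! Property (S) makes `(B, +)` an FC-group and all `λ`-orbits finite. A finitely generated FC-group
has finite commutator subgroup (Schur), so its torsion can be read off in the abelianization and is
finite.

For finite `E` the `λ`-orbits of `E` additively generate a finitely generated sub-skew brace,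
`lamClosure E`. If `E` is a single additively periodic element, it is finite, so `T_+ ⊆ T_∘`.
Conversely, `Fix^r(a)` has finite index, so some positive multiple of `x` is fixed by `λ_a`; hence
`λ_a` is trivial modulo `T_+`, where the two operations then agree, and `T_∘ ⊆ T_+`. If `E`
generates `B`, then `lamClosure E` is all of `B`, which gives (4). -/

/-! ### Torsion in FC-groups -/

theorem Subgroup.isOfFinOrder_coe_iff {G : Type*} [Group G] {H : Subgroup G} {x : H} :
    IsOfFinOrder (x : G) ↔ IsOfFinOrder x :=
  Submonoid.isOfFinOrder_coe (H := H.toSubmonoid)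

/-- A commutator depends only on the cosets of its two entries modulo the centre. -/
theorem finite_commutatorSet_of_finiteIndex_center (G : Type*) [Group G]
    [(Subgroup.center G).FiniteIndex] : Finite (commutatorSet G) := by
  have h : commutatorSet G ⊆ Set.range
      (fun p : (G ⧸ Subgroup.center G) × (G ⧸ Subgroup.center G) =>
        p.1.out * p.2.out * p.1.out⁻¹ * p.2.out⁻¹) := by
    rintro _ ⟨a, b, rfl⟩
    refine ⟨(a, b), ?_⟩
    obtain ⟨y, hy⟩ := QuotientGroup.mk_out_eq_mul (Subgroup.center G) a
    obtain ⟨z, hz⟩ := QuotientGroup.mk_out_eq_mul (Subgroup.center G) b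
    have hy' (g : G) : (y : G) * g * (y : G)⁻¹ = g := by
      rw [← Subgroup.mem_center_iff.mp y.2 g, mul_inv_cancel_right]
    have hz' (g : G) : (z : G) * g * (z : G)⁻¹ = g := by
      rw [← Subgroup.mem_center_iff.mp z.2 g, mul_inv_cancel_right]
    calc _ = a * (y * (b * z) * (y : G)⁻¹) * a⁻¹ * (b * z)⁻¹ := by simp only [hy, hz]; group
      _ = a * b * (z * a⁻¹ * (z : G)⁻¹) * b⁻¹ := by rw [hy']; group
      _ = _ := by rw [hz', commutatorElement_def]
  exact ((Set.finite_range _).subset h).to_subtype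

/-- The centre is the intersection of the centralizers of finitely many generators. -/
theorem finiteIndex_center_of_fg {G : Type*} [Group G] [Group.FG G]
    (hG : ∀ x : G, (Subgroup.centralizer {x}).FiniteIndex) :
    (Subgroup.center G).FiniteIndex := by
  obtain ⟨S, hS⟩ := Group.fg_def.mp ‹Group.FG G›
  rw [← Subgroup.centralizer_univ, ← Subgroup.coe_top, ← hS, Subgroup.centralizer_closure,
    Subgroup.centralizer_eq_iInf]
  exact Subgroup.finiteIndex_iInf' (fun x => Subgroup.centralizer {x}) fun x _ => hG x

theorem AddCommGroup.finite_setOf_isOfFinAddOrder (A : Type*) [AddCommGroup A] [AddGroup.FG A] :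
    {x : A | IsOfFinAddOrder x}.Finite := by
  let T : Submodule ℤ A := (AddCommGroup.torsion A).toIntSubmodule
  -- `ℤ` is Noetherian, so the torsion submodule is again finitely generated.
  have : AddGroup.FG T := Module.Finite.iff_addGroup_fg.mp inferInstance
  have : Finite T := AddCommGroup.finite_of_fg_isAddTorsion T fun x =>
    (AddSubmonoid.isOfFinAddOrder_coe (H := T.toAddSubmonoid)).mp x.2
  exact Set.toFinite (T : Set A)

theorem CommGroup.finite_setOf_isOfFinOrder (A : Type*) [CommGroup A] [Group.FG A] :
    {x : A | IsOfFinOrder x}.Finite :=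
  ((AddCommGroup.finite_setOf_isOfFinAddOrder (Additive A)).preimage
    Additive.ofMul.injective.injOn).subset fun _ hx =>
      isOfFinAddOrder_ofMul_iff.mpr hx

theorem finite_commutator_of_fg {G : Type*} [Group G] [Group.FG G]
    (hG : ∀ x : G, (Subgroup.centralizer {x}).FiniteIndex) : Finite (commutator G) := by
  have := finiteIndex_center_of_fg hG
  have := finite_commutatorSet_of_finiteIndex_center G
  -- Schur's theorem: finitely many commutators generate a finite subgroup.
  infer_instance

theorem isOfFinOrder_of_abelianization {G : Type*} [Group G] [Finite (commutator G)] {x : G}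
    (hx : IsOfFinOrder (Abelianization.of x)) : IsOfFinOrder x := by
  obtain ⟨n, hn, h⟩ := isOfFinOrder_iff_pow_eq_one.mp hx
  rw [← map_pow, ← MonoidHom.mem_ker, Abelianization.ker_of] at h
  have h' : IsOfFinOrder (x ^ n) :=
    Subgroup.isOfFinOrder_coe_iff.mpr (isOfFinOrder_of_finite (⟨x ^ n, h⟩ : commutator G))
  exact (isOfFinOrder_pow.mp h').resolve_right hn.ne'

/-- The abelianization has finite torsion, and the fibres over it are cosets of the finite
commutator subgroup. -/
theorem finite_setOf_isOfFinOrder_of_fg {G : Type*} [Group G] [Group.FG G]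
    (hG : ∀ x : G, (Subgroup.centralizer {x}).FiniteIndex) : {x : G | IsOfFinOrder x}.Finite := by
  have := finite_commutator_of_fg hG
  have hsurj : Function.Surjective (Abelianization.of (G := G)) := QuotientGroup.mk_surjective
  have : Group.FG (Abelianization G) := Group.fg_of_surjective hsurj
  refine ((CommGroup.finite_setOf_isOfFinOrder (Abelianization G)).preimage'
    (f := Abelianization.of) fun b _ => ?_).subset fun x hx => Abelianization.of.isOfFinOrder hx
  obtain ⟨y, rfl⟩ := hsurj b
  refine ((Set.toFinite (commutator G : Set G)).image (y * ·)).subset fun x hx => ?_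
  refine ⟨y⁻¹ * x, ?_, mul_inv_cancel_left y x⟩
  rw [SetLike.mem_coe, ← Abelianization.ker_of, MonoidHom.mem_ker, map_mul, map_inv, hx,
    inv_mul_cancel]

section FC

variable {G : Type*} [Group G]

theorem finiteIndex_centralizer_subgroup (hG : ∀ x : G, (Subgroup.centralizer {x}).FiniteIndex)
    (H : Subgroup G) (x : H) : (Subgroup.centralizer {x}).FiniteIndex := by
  have := hG x
  refine Subgroup.finiteIndex_of_le (H := (Subgroup.centralizer {(x : G)}).subgroupOf H)
    fun y hy => ?_
  rw [Subgroup.mem_subgroupOf, Subgroup.mem_centralizer_singleton_iff] at hy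
  rw [Subgroup.mem_centralizer_singleton_iff]
  exact Subtype.ext hy

theorem finite_setOf_mem_closure_isOfFinOrder
    (hG : ∀ x : G, (Subgroup.centralizer {x}).FiniteIndex) {S : Set G} (hS : S.Finite) :
    {x : G | x ∈ Subgroup.closure S ∧ IsOfFinOrder x}.Finite := by
  have := hS.to_subtype
  have := finite_setOf_isOfFinOrder_of_fg
    (finiteIndex_centralizer_subgroup hG (Subgroup.closure S))
  refine (this.image Subtype.val).subset ?_
  rintro x ⟨hx, h⟩
  exact ⟨⟨x, hx⟩, Subgroup.isOfFinOrder_coe_iff.mp h, rfl⟩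

/-- Reduces statements about the torsion of two elements to an abelian group, via
`isOfFinOrder_of_abelianization`. -/
theorem exists_subgroup_finite_commutator_of_pair
    (hG : ∀ x : G, (Subgroup.centralizer {x}).FiniteIndex) (a b : G) : ∃ (H : Subgroup G), a ∈ H ∧ b ∈ H ∧ Finite (commutator H) :=
  ⟨Subgroup.closure {a, b}, Subgroup.subset_closure (by simp), Subgroup.subset_closure (by simp),
    finite_commutator_of_fg (finiteIndex_centralizer_subgroup hG _)⟩

theorem IsOfFinOrder.mul_of_finiteIndex_centralizer
    (hG : ∀ x : G, (Subgroup.centralizer {x}).FiniteIndex) {a b : G}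
    (ha : IsOfFinOrder a) (hb : IsOfFinOrder b) : IsOfFinOrder (a * b) := by
  obtain ⟨H, haH, hbH, _⟩ := exists_subgroup_finite_commutator_of_pair hG a b
  lift a to H using haH
  lift b to H using hbH
  rw [Subgroup.isOfFinOrder_coe_iff] at ha hb
  rw [← Subgroup.coe_mul, Subgroup.isOfFinOrder_coe_iff]
  refine isOfFinOrder_of_abelianization ?_
  rw [map_mul]
  exact (Abelianization.of.isOfFinOrder ha).mul (Abelianization.of.isOfFinOrder hb)

theorem isOfFinOrder_inv_mul_of_pow_eq_pow
    (hG : ∀ x : G, (Subgroup.centralizer {x}).FiniteIndex) {a b : G} {n : ℕ} (hn : n ≠ 0)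
    (h : a ^ n = b ^ n) : IsOfFinOrder (a⁻¹ * b) := by
  obtain ⟨H, haH, hbH, _⟩ := exists_subgroup_finite_commutator_of_pair hG a b
  lift a to H using haH
  lift b to H using hbH
  rw [← Subgroup.coe_inv, ← Subgroup.coe_mul, Subgroup.isOfFinOrder_coe_iff]
  refine isOfFinOrder_of_abelianization (isOfFinOrder_iff_pow_eq_one.mpr ⟨n, hn.bot_lt, ?_⟩)
  have h' : a ^ n = b ^ n := Subtype.ext h
  rw [map_mul, mul_pow, map_inv, inv_pow, ← map_pow, ← map_pow, h', inv_mul_cancel]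

end FC

/-! ### Torsion in skew braces with property (S) -/

namespace SkewBrace

variable {B : Type*} [SkewBrace B]

theorem HasPropertyS.finiteIndex_centralizer (hS : HasPropertyS B) (x : Multiplicative B) :
    (Subgroup.centralizer {x}).FiniteIndex := by
  have := (hS x.toAdd).1
  have h : (AddSubgroup.centralizer {x.toAdd}).FiniteIndex :=
    AddSubgroup.finiteIndex_of_le (inf_le_right (a := fixR x.toAdd))
  exact ⟨h.index_ne_zero⟩

/-- Orbit-stabilizer: `fixL x` is the stabilizer of `x` under the action `λ` of `(B, ∘)`. -/
theorem HasPropertyS.finite_lam_orbit (hS : HasPropertyS B) (x : B) :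
    (Set.range fun a => lam a x).Finite := by
  have := (hS x).2
  have : (fixL x).FiniteIndex :=
    Subgroup.finiteIndex_of_le (inf_le_left (b := Subgroup.centralizer {x}))
  refine (Set.finite_range fun q : B ⧸ fixL x => lam q.out x).subset ?_
  rintro _ ⟨a, rfl⟩
  obtain ⟨y, hy⟩ := QuotientGroup.mk_out_eq_mul (fixL x) a
  exact ⟨a, by simp only [hy, lam_mul, (astOp_eq_zero_iff _ _).mp y.2]⟩

/-- `λ_a` as an endomorphism of `(B, +)`. -/
def lamHom (a : B) : B →+ B where
  toFun := lam a
  map_zero' := lam_zero a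
  map_add' := lam_add a

/-- The additive subgroup generated by the `λ`-orbits of the elements of a set. -/
def lamClosure (E : Set B) : AddSubgroup B :=
  AddSubgroup.closure (⋃ x ∈ E, Set.range fun a => lam a x)

theorem subset_lamClosure (E : Set B) : E ⊆ lamClosure E := fun x hx =>
  AddSubgroup.subset_closure (Set.mem_biUnion hx ⟨1, lam_one x⟩)

theorem lam_mem_lamClosure {E : Set B} (a : B) {x : B} (hx : x ∈ lamClosure E) :
    lam a x ∈ lamClosure E := by
  have h : lamClosure E ≤ (lamClosure E).comap (lamHom a) := by
    rw [lamClosure, AddSubgroup.closure_le]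
    simp only [Set.iUnion_subset_iff, Set.range_subset_iff]
    intro y hy b
    exact AddSubgroup.subset_closure (Set.mem_biUnion hy ⟨a * b, lam_mul a b y⟩)
  exact h hx

/-- A `λ`-invariant additive subgroup is a sub-skew brace. -/
def SubSkewBrace.ofLamInvariant (A : AddSubgroup B) (hA : ∀ a, ∀ x ∈ A, lam a x ∈ A) :
    SubSkewBrace B where
  toAddSubgroup := A
  one_mem' := by
    rw [one_eq_zero]
    exact A.zero_mem
  mul_mem' := by
    intro a b ha hb
    rw [mul_eq_add_lam]
    exact A.add_mem ha (hA a b hb)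
  inv_mem' := by
    intro a ha
    have h := A.neg_mem (hA a⁻¹ a ha)
    rwa [lam_inv_self, neg_neg] at h

theorem HasPropertyS.finite_torsion_lamClosure (hS : HasPropertyS B) {E : Set B} (hE : E.Finite) :
    {x | x ∈ lamClosure E ∧ IsOfFinAddOrder x}.Finite := by
  have hF := hE.biUnion fun x _ => hS.finite_lam_orbit x
  refine ((finite_setOf_mem_closure_isOfFinOrder hS.finiteIndex_centralizer
    (hF.preimage Multiplicative.toAdd.injective.injOn)).preimage
    Multiplicative.ofAdd.injective.injOn).subset ?_
  rintro x ⟨hx, h⟩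
  refine ⟨?_, isOfFinOrder_ofAdd_iff.mpr h⟩
  rwa [← AddSubgroup.toSubgroup_closure]

/-- The additive torsion subgroup of a skew brace with property (S). -/
def HasPropertyS.addTorsion (hS : HasPropertyS B) : AddSubgroup B where
  carrier := addTorsionSet B
  zero_mem' := IsOfFinAddOrder.zero
  add_mem' := fun ha hb => isOfFinOrder_ofAdd_iff.mp <|
    (isOfFinOrder_ofAdd_iff.mpr ha).mul_of_finiteIndex_centralizer hS.finiteIndex_centralizer
      (isOfFinOrder_ofAdd_iff.mpr hb)
  neg_mem' := fun ha => IsOfFinAddOrder.neg ha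

theorem isOfFinAddOrder_lam {x : B} (a : B) (hx : IsOfFinAddOrder x) :
    IsOfFinAddOrder (lam a x) :=
  (lamHom a).isOfFinAddOrder hx

theorem isOfFinAddOrder_conj {x : B} (a : B) (hx : IsOfFinAddOrder x) :
    IsOfFinAddOrder (a + x - a) := by
  rw [sub_eq_add_neg]
  exact (AddAut.addConj a).toAddMonoidHom.isOfFinAddOrder hx

theorem HasPropertyS.normal_addTorsion (hS : HasPropertyS B) : hS.addTorsion.Normal :=
  ⟨fun x hx a => by
    rw [← sub_eq_add_neg]
    exact isOfFinAddOrder_conj a hx⟩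

theorem HasPropertyS.isOfFinOrder_of_isOfFinAddOrder (hS : HasPropertyS B) {x : B}
    (hx : IsOfFinAddOrder x) : IsOfFinOrder x := by
  let A := lamClosure {x}
  have hA : A ≤ hS.addTorsion := by
    simp only [A, lamClosure, AddSubgroup.closure_le, Set.iUnion_subset_iff,
      Set.range_subset_iff, Set.mem_singleton_iff]
    rintro _ rfl a
    exact isOfFinAddOrder_lam a hx
  have hfin : (A : Set B).Finite :=
    (hS.finite_torsion_lamClosure (Set.finite_singleton x)).subset fun y hy => ⟨hy, hA hy⟩
  -- The finite set `A` is also a subgroup of `(B, ∘)`, so `x` has finite order there.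
  let H : Subgroup B :=
    (SubSkewBrace.ofLamInvariant A fun a _ h => lam_mem_lamClosure a h).toSubgroup
  have : Finite H := hfin.to_subtype
  exact Subgroup.isOfFinOrder_coe_iff.mpr
    (isOfFinOrder_of_finite (⟨x, subset_lamClosure {x} rfl⟩ : H))

theorem HasPropertyS.isOfFinAddOrder_neg_add_lam (hS : HasPropertyS B) (a x : B) :
    IsOfFinAddOrder (-lam a x + x) := by
  have := (hS a).1
  have : (fixR a).FiniteIndex :=
    AddSubgroup.finiteIndex_of_le (inf_le_left (b := AddSubgroup.centralizer {a}))
  obtain ⟨n, hn, -, h⟩ := (fixR a).exists_nsmul_mem_of_index_ne_zero this.index_ne_zero x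
  have h' : n • lam a x = n • x :=
    (map_nsmul (lamHom a) n x).symm.trans ((astOp_eq_zero_iff _ _).mp h)
  exact isOfFinOrder_ofAdd_iff.mp <| isOfFinOrder_inv_mul_of_pow_eq_pow
    hS.finiteIndex_centralizer (a := Multiplicative.ofAdd (lam a x))
    (b := Multiplicative.ofAdd x) hn.ne' h'

theorem HasPropertyS.isOfFinAddOrder_of_isOfFinOrder (hS : HasPropertyS B) {x : B}
    (hx : IsOfFinOrder x) : IsOfFinAddOrder x := by
  have := hS.normal_addTorsion
  let q : B →+ B ⧸ hS.addTorsion := QuotientAddGroup.mk' hS.addTorsion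
  have hlam (a y : B) : q (lam a y) = q y :=
    QuotientAddGroup.eq.mpr (hS.isOfFinAddOrder_neg_add_lam a y)
  -- As `λ` is trivial modulo `T_+`, multiplicative powers become additive multiples there.
  have hpow (k : ℕ) : q (x ^ k) = k • q x := by
    induction k with
    | zero => rw [pow_zero, one_eq_zero, map_zero, zero_nsmul]
    | succ k ih => rw [pow_succ, mul_eq_add_lam, map_add, hlam, ih, succ_nsmul]
  obtain ⟨n, hn, h⟩ := isOfFinOrder_iff_pow_eq_one.mp hx
  have h0 : q (n • x) = 0 := by rw [map_nsmul, ← hpow, h, one_eq_zero, map_zero]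
  have h1 : IsOfFinAddOrder (n • x) := (QuotientAddGroup.eq_zero_iff _).mp h0
  exact (isOfFinAddOrder_nsmul.mp h1).resolve_right hn.ne'

theorem HasPropertyS.addTorsionSet_eq_mulTorsionSet (hS : HasPropertyS B) :
    addTorsionSet B = mulTorsionSet B :=
  Set.Subset.antisymm (fun _ => hS.isOfFinOrder_of_isOfFinAddOrder)
    (fun _ => hS.isOfFinAddOrder_of_isOfFinOrder)

/-- The additive torsion subgroup as an ideal. -/
def HasPropertyS.torsionIdeal (hS : HasPropertyS B) : BraceIdeal B where
  toAddSubgroup := hS.addTorsion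
  lam_mem := fun a _ hx => isOfFinAddOrder_lam a hx
  add_conj_mem := fun a _ hx => isOfFinAddOrder_conj a hx
  -- Conjugation in `(B, ∘)` is only known to preserve multiplicative order, hence the detour
  -- through `T_∘`.
  mul_conj_mem := fun a _ hx => hS.isOfFinAddOrder_of_isOfFinOrder
    ((MulAut.conj a).toMonoidHom.isOfFinOrder (hS.isOfFinOrder_of_isOfFinAddOrder hx))

theorem HasPropertyS.addTorsionSet_quotient (hS : HasPropertyS B) :
    addTorsionSet hS.torsionIdeal.Quotient = {0} := by
  refine Set.Subset.antisymm (fun y hy => ?_) (Set.singleton_subset_iff.mpr IsOfFinAddOrder.zero)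
  obtain ⟨x, rfl⟩ := hS.torsionIdeal.proj_surjective y
  obtain ⟨n, hn, h⟩ := isOfFinAddOrder_iff_nsmul_eq_zero.mp hy
  let p : B →+ hS.torsionIdeal.Quotient := AddMonoidHom.mk' _ hS.torsionIdeal.proj_add
  have hp (z : B) : p z = 0 ↔ IsOfFinAddOrder z := by
    rw [← map_zero p, eq_comm]
    refine (hS.torsionIdeal.proj_eq_iff_add 0 z).trans ?_
    rw [neg_zero, zero_add]
    rfl
  have h1 : IsOfFinAddOrder (n • x) := (hp _).mp ((map_nsmul p n x).trans h)
  exact (hp x).mpr ((isOfFinAddOrder_nsmul.mp h1).resolve_right hn.ne')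

theorem HasPropertyS.finite_addTorsionSet (hS : HasPropertyS B) (hB : IsFinitelyGenerated B) :
    (addTorsionSet B).Finite := by
  obtain ⟨E, hE⟩ := hB
  have h := hE (SubSkewBrace.ofLamInvariant (lamClosure E) fun a _ h => lam_mem_lamClosure a h)
    (subset_lamClosure _)
  refine (hS.finite_torsion_lamClosure E.finite_toSet).subset fun x hx => ⟨?_, hx⟩
  exact h.symm.subset (Set.mem_univ x)

end SkewBrace

theorem mainTheorem5 {B : Type*} [SkewBrace B] (hS : SkewBrace.HasPropertyS B) :
    SkewBrace.addTorsionSet B = SkewBrace.mulTorsionSet B ∧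
    (∃ I : SkewBrace.BraceIdeal B,
      I.carrier = SkewBrace.addTorsionSet B ∧
      SkewBrace.addTorsionSet I.Quotient = {0}) ∧
    (SkewBrace.IsFinitelyGenerated B → (SkewBrace.addTorsionSet B).Finite) :=
  ⟨hS.addTorsionSet_eq_mulTorsionSet, ⟨hS.torsionIdeal, rfl, hS.addTorsionSet_quotient⟩,
    hS.finite_addTorsionSet⟩
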